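/- For integers $n \ge 2$ and $D \ge 1$ let $[n]^{D} = \{1,\dots,n\}^{D}$ be partially ordered by $x \preccurlyeq y$ if and only if $x_i \le y_i$ for all $1 \le i \le D$. Let $\mathcal{A}_{D,n}$ be the total number of antichains in $[n]^{D}$ (that is, of subsets $A \subseteq [n]^D$ in which no two distinct elements are comparable, the empty set included), and let $N_{D,n}$ be the size of the middle layer, that is, the number of $(x_1,\dots,x_D) \in [n]^{D}$ with $x_1+\dots+x_D = \lfloor D(n+1)/2 \rfloor$. Then for every $n \ge 2$ there is a constant $C_n > 0$, depending only on $n$, such that for every integer $d \ge 2$ $$\mathcal{A}_{d+1,n} \le 2^{\left(1 + \frac{C_n \log d}{\sqrt{d}}\right) N_{d+1,n}}.$$ -/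

import Mathlib

/-- The box `[n]^D`, where `[n] = {1, …, n}`: the vectors `(x_1, …, x_D)` of natural numbers with
`1 ≤ x_i ≤ n` for all `i`. It is ordered by the coordinatewise order of `Fin D → ℕ`. -/
def box (D n : ℕ) : Finset (Fin D → ℕ) :=
  Fintype.piFinset fun _ => Finset.Icc 1 n

open Classical in
/-- The set of all antichains (the empty one included) of the box `[n]^D`
with respect to the coordinatewise order. -/
noncomputable def boxAntichains (D n : ℕ) : Finset (Finset (Fin D → ℕ)) :=
  (box D n).powerset.filter fun A => IsAntichain (· ≤ ·) (A : Set (Fin D → ℕ))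

/-- The middle layer of `[n]^D`: the points of the box whose coordinate sum is `D (n + 1) / 2`,
rounded down if this is not an integer. -/
def middleLayer (D n : ℕ) : Finset (Fin D → ℕ) :=
  (box D n).filter fun x => ∑ i, x i = D * (n + 1) / 2

/-!
Write `N` for the size of the middle layer of `[n]^D`, where `D = d + 1`. Antichains are the
independent sets of the comparability graph, and they are counted by repeatedly branching on a point
with many points above it. This works as soon as every set of slightly more than `N` points has such
a point.

*Supersaturation.* A symmetric chain decomposition splits the box into at most `N` chains
(`exists_chain_labelling`). Apply a random permutation of the coordinates to it. Every set `F` still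
has at least `#F - N` pairs that lie in a common chain
(`card_le_card_middleLayer_add_card_pairs`). On the other hand, fix `x < y` such that every value in
`[n]` is taken by at least `D / (2 n)` coordinates of `x`, and such that the coordinate sums of `x`
and `y` differ by at most `D / (4 n)`. Then `y` increases some but not all coordinates of a large
level set of `x`, so transpositions fixing `x` carry `y` to at least `D / (4 n)` points of the same
layer. Only one of them can share a chain with `x`, so `x` and `y` share a chain with probability at
most `4 n / D` (`card_perm_same_label_le_of_typical`). Hence `F` contains at least
`(#F - N) * D / (4 n)` comparable pairs (`mul_le_card_comparable_pairs`). By Chebyshev's inequality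
all but `O(n ^ D / D)` points are typical in this sense, and since `n ^ D = O(√D N)`, these
exceptions change the logarithm of the number of antichains only by `O(N / √D)`.

*Counting.* If all subsets with more than `M` points have a point with at least `Δ` points above it,
then the recursion `f F ≤ f (F - v) + f (F - v - {y | v < y})` shows that going from a set `F` down
to sets of size `M` costs a factor of at most `exp (log D / Δ * #F)`
(`card_antichainsIn_le_mul_exp`). Supersaturation gives `Δ` of order `D` while more than `2 N` points
are left, and `Δ` of order `√D` from there to `(1 + 1 / √D) N` points. Both rounds cost
`O(N log D / √D)` in the exponent, and what remains contributes `2 ^ ((1 + 1 / √D) N)`.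
-/

/-! ### Chain partitions of the box -/

lemma mem_box {D n : ℕ} {x : Fin D → ℕ} : x ∈ box D n ↔ ∀ i, 1 ≤ x i ∧ x i ≤ n := by
  simp [box]

lemma card_box (D n : ℕ) : (box D n).card = n ^ D := by
  simp [box, Fintype.card_piFinset]

lemma cons_mem_box {D n b : ℕ} {x : Fin D → ℕ} :
    (Fin.cons b x : Fin (D + 1) → ℕ) ∈ box (D + 1) n ↔ (1 ≤ b ∧ b ≤ n) ∧ x ∈ box D n := by
  simp [mem_box, Fin.forall_fin_succ]

/-- The symmetric chain decomposition of de Bruijn, Tengbergen and Kruyswijk. The points with label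
`l` form a chain that has exactly one point of each coordinate sum from `lo l` to
`D * (n + 1) - lo l`. -/
lemma exists_symmetric_chain_labelling (n D : ℕ) :
    ∃ (α : Type) (c : (Fin D → ℕ) → α) (lo : α → ℕ),
      (∀ x ∈ box D n, ∀ y ∈ box D n, c x = c y → ∑ i, x i ≤ ∑ i, y i → x ≤ y) ∧
      (∀ x ∈ box D n, lo (c x) ≤ ∑ i, x i ∧ ∑ i, x i + lo (c x) ≤ D * (n + 1)) ∧
      (∀ x ∈ box D n, ∀ s, lo (c x) ≤ s → s + lo (c x) ≤ D * (n + 1) →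
        ∃ y ∈ box D n, c y = c x ∧ ∑ i, y i = s) := by
  induction D with
  | zero =>
    refine ⟨Unit, fun _ => (), fun _ => 0, ?_, ?_, ?_⟩
    · intro x _ y _ _ _ i
      exact i.elim0
    · simp
    · intro x hx s _ hs
      exact ⟨x, hx, rfl, by simp at hs ⊢; omega⟩
  | succ D ih =>
    obtain ⟨α, c, lo, hchain, hrange, hex⟩ := ih
    -- The product of a chain with `[n]` is a rectangle, which is cut into hooks.
    -- The hook through a point is the smaller of its distances to two sides of the rectangle.
    refine ⟨α × ℕ, fun z => (c (Fin.tail z), min (z 0 - 1)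
      (D * (n + 1) - lo (c (Fin.tail z)) - ∑ i, Fin.tail z i)), fun l => lo l.1 + 1 + l.2,
      ?_, ?_, ?_⟩
    · intro z
      refine Fin.consCases (fun b x => ?_) z
      intro hz w
      refine Fin.consCases (fun b' x' => ?_) w
      intro hw hc hs
      simp only [Fin.tail_cons, Fin.cons_zero, Prod.mk.injEq] at hc
      obtain ⟨hc, hj⟩ := hc
      rw [cons_mem_box] at hz hw
      simp only [Fin.sum_univ_succ, Fin.cons_zero, Fin.cons_succ] at hs
      have h1 := hrange x hz.2
      have h2 := hrange x' hw.2
      rw [← hc] at hj h2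
      have key : ∑ i, x i ≤ ∑ i, x' i ∧ b ≤ b' := by omega
      have hx := hchain x hz.2 x' hw.2 hc key.1
      intro i
      refine Fin.cases ?_ (fun i => ?_) i
      · simpa using key.2
      · simpa using hx i
    · intro z
      refine Fin.consCases (fun b x => ?_) z
      intro hz
      rw [cons_mem_box] at hz
      have h1 := hrange x hz.2
      simp only [Fin.tail_cons, Fin.cons_zero, Fin.sum_univ_succ, Fin.cons_succ, add_mul, one_mul]
        at h1 ⊢
      omega
    · intro z
      refine Fin.consCases (fun b x => ?_) z
      intro hz s hs1 hs2
      rw [cons_mem_box] at hz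
      have h1 := hrange x hz.2
      have hT : (D + 1) * (n + 1) = D * (n + 1) + n + 1 := by ring
      rw [hT] at hs2
      simp only [Fin.tail_cons, Fin.cons_zero] at hs1 hs2 ⊢
      generalize hj : min (b - 1) (D * (n + 1) - lo (c x) - ∑ i, x i) = j at hs1 hs2 ⊢
      generalize D * (n + 1) = T at *
      by_cases hs : s ≤ T - lo (c x) + 1
      · obtain ⟨y, hy, hcy, hsy⟩ := hex x hz.2 (s - j - 1) (by omega) (by omega)
        refine ⟨Fin.cons (j + 1) y, cons_mem_box.2 ⟨by omega, hy⟩, ?_, ?_⟩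
        · simp only [Fin.tail_cons, Fin.cons_zero, Prod.mk.injEq, hcy, hsy, true_and]
          omega
        · simp only [Fin.sum_univ_succ, Fin.cons_zero, Fin.cons_succ, hsy]
          omega
      · obtain ⟨y, hy, hcy, hsy⟩ := hex x hz.2 (T - lo (c x) - j) (by omega) (by omega)
        refine ⟨Fin.cons (s - (T - lo (c x) - j)) y, cons_mem_box.2 ⟨by omega, hy⟩, ?_, ?_⟩
        · simp only [Fin.tail_cons, Fin.cons_zero, Prod.mk.injEq, hcy, hsy, true_and]
          omega
        · simp only [Fin.sum_univ_succ, Fin.cons_zero, Fin.cons_succ, hsy]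
          omega

open Classical in
/-- The box is partitioned into at most as many chains as the middle layer has points. -/
lemma exists_chain_labelling (n D : ℕ) :
    ∃ (α : Type) (c : (Fin D → ℕ) → α),
      (∀ x ∈ box D n, ∀ y ∈ box D n, c x = c y → ∑ i, x i ≤ ∑ i, y i → x ≤ y) ∧
      ((box D n).image c).card ≤ (middleLayer D n).card := by
  obtain ⟨α, c, lo, hchain, hrange, hex⟩ := exists_symmetric_chain_labelling n D
  refine ⟨α, c, hchain, ?_⟩
  refine (Finset.card_le_card (t := (middleLayer D n).image c) ?_).trans Finset.card_image_le
  intro l hl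
  obtain ⟨x, hx, rfl⟩ := Finset.mem_image.1 hl
  have h := hrange x hx
  obtain ⟨y, hy, hcy, hsy⟩ := hex x hx (D * (n + 1) / 2) (by omega) (by omega)
  exact Finset.mem_image.2 ⟨y, Finset.mem_filter.2 ⟨hy, hsy⟩, hcy⟩

lemma card_layer_le (n D s : ℕ) :
    ((box D n).filter fun x => ∑ i, x i = s).card ≤ (middleLayer D n).card := by
  classical
  obtain ⟨α, c, hchain, hcard⟩ := exists_chain_labelling n D
  refine (Finset.card_le_card_of_injOn c ?_ ?_).trans hcard
  · intro x hx
    exact Finset.mem_coe.2 (Finset.mem_image_of_mem c (Finset.mem_filter.1 hx).1)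
  · intro x hx y hy h
    obtain ⟨hx, hxs⟩ := Finset.mem_filter.1 hx
    obtain ⟨hy, hys⟩ := Finset.mem_filter.1 hy
    exact le_antisymm (hchain x hx y hy h (by omega)) (hchain y hy x hx h.symm (by omega))

/-! ### Second moments on the box -/

lemma sum_box_succ (n D : ℕ) (g : (Fin (D + 1) → ℕ) → ℝ) :
    ∑ z ∈ box (D + 1) n, g z = ∑ x ∈ box D n, ∑ b ∈ Finset.Icc 1 n, g (Fin.cons b x) := by
  rw [← Finset.sum_product']
  refine Finset.sum_nbij' (fun z => (Fin.tail z, z 0)) (fun p => Fin.cons p.2 p.1) ?_ ?_ ?_ ?_ ?_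
  · intro z
    refine Fin.consCases (fun b x => ?_) z
    intro hz
    rw [cons_mem_box] at hz
    simpa using hz.symm
  · rintro ⟨x, b⟩ h
    rw [cons_mem_box]
    simpa using (Finset.mem_product.1 h).symm
  · intro z _
    simp
  · intro p _
    simp
  · intro z _
    simp

/-- The variance of a sum of `D` independent centred variables, each a function of a uniform
element of `[n]`. -/
lemma sum_box_sum_sq (n D : ℕ) (h : ℕ → ℝ) (h0 : ∑ a ∈ Finset.Icc 1 n, h a = 0) :
    n * ∑ x ∈ box D n, (∑ i, h (x i)) ^ 2 = D * n ^ D * ∑ a ∈ Finset.Icc 1 n, h a ^ 2 := by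
  induction D with
  | zero => simp
  | succ D ih =>
    have e : ∀ x : Fin D → ℕ, ∑ b ∈ Finset.Icc 1 n,
        (∑ i, h ((Fin.cons b x : Fin (D + 1) → ℕ) i)) ^ 2 =
        ∑ b ∈ Finset.Icc 1 n, h b ^ 2 + n * (∑ i, h (x i)) ^ 2 := by
      intro x
      simp only [Fin.sum_univ_succ, Fin.cons_zero, Fin.cons_succ, add_sq, Finset.sum_add_distrib]
      rw [← Finset.sum_mul, ← Finset.mul_sum, h0]
      simp
    rw [sum_box_succ, Finset.sum_congr rfl fun x _ => e x, Finset.sum_add_distrib,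
      ← Finset.mul_sum, ih, Finset.sum_const, card_box, nsmul_eq_mul]
    push_cast
    ring

/-- Chebyshev's inequality on the box. -/
lemma card_large_deviation_mul_sq_le (n D : ℕ) (hn : 1 ≤ n) (h : ℕ → ℝ)
    (h0 : ∑ a ∈ Finset.Icc 1 n, h a = 0) (hb : ∀ a ∈ Finset.Icc 1 n, |h a| ≤ n)
    (t : ℝ) (ht : 0 ≤ t) :
    (((box D n).filter fun x => t ≤ |∑ i, h (x i)|).card : ℝ) * t ^ 2 ≤ D * n ^ 2 * n ^ D := by
  have hn' : (0 : ℝ) < n := by exact_mod_cast hn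
  have h2 : ∑ a ∈ Finset.Icc 1 n, h a ^ 2 ≤ n * n ^ 2 := by
    refine (Finset.sum_le_card_nsmul _ _ ((n : ℝ) ^ 2) fun a ha => ?_).trans (by simp)
    exact sq_le_sq.2 ((hb a ha).trans (le_abs_self _))
  have h3 := sum_box_sum_sq n D h h0
  have h4 : (((box D n).filter fun x => t ≤ |∑ i, h (x i)|).card : ℝ) * t ^ 2 ≤
      ∑ x ∈ box D n, (∑ i, h (x i)) ^ 2 := by
    rw [← nsmul_eq_mul]
    refine (Finset.card_nsmul_le_sum _ (fun x => (∑ i, h (x i)) ^ 2) _ fun x hx => ?_).trans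
      (Finset.sum_le_sum_of_subset_of_nonneg (Finset.filter_subset _ _)
        fun x _ _ => sq_nonneg _)
    rw [← sq_abs (∑ i, h (x i))]
    exact pow_le_pow_left₀ ht (Finset.mem_filter.1 hx).2 2
  refine h4.trans (le_of_mul_le_mul_left ?_ hn')
  rw [h3]
  calc (D : ℝ) * n ^ D * ∑ a ∈ Finset.Icc 1 n, h a ^ 2 ≤ D * n ^ D * (n * n ^ 2) := by gcongr
    _ = n * (D * n ^ 2 * n ^ D) := by ring

lemma sum_Icc_two_mul_sub (n : ℕ) :
    ∑ a ∈ Finset.Icc 1 n, (2 * (a : ℝ) - (n + 1)) = 0 := by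
  have h : ∑ a ∈ Finset.Icc 1 n, (a : ℝ) = n * (n + 1) / 2 := by
    induction n with
    | zero => simp
    | succ n ih =>
      rw [Finset.sum_Icc_succ_top (by omega), ih]
      push_cast
      ring
  rw [Finset.sum_sub_distrib, ← Finset.mul_sum, h]
  simp
  ring

lemma card_sum_deviation_mul_sq_le (n D : ℕ) (hn : 1 ≤ n) (t : ℝ) (ht : 0 ≤ t) :
    (((box D n).filter fun x => t ≤ |2 * ∑ i, (x i : ℝ) - D * (n + 1)|).card : ℝ) * t ^ 2 ≤
      D * n ^ 2 * n ^ D := by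
  have key := card_large_deviation_mul_sq_le n D hn (fun a => 2 * (a : ℝ) - (n + 1))
    (sum_Icc_two_mul_sub n) ?_ t ht
  · simpa [Finset.sum_sub_distrib, ← Finset.mul_sum, mul_add] using key
  · intro a ha
    rw [Finset.mem_Icc] at ha
    have h1 : (1 : ℝ) ≤ a := by exact_mod_cast ha.1
    have h2 : (a : ℝ) ≤ n := by exact_mod_cast ha.2
    rw [abs_le]
    constructor <;> linarith

lemma card_level_deviation_mul_sq_le (n D a : ℕ) (hn : 1 ≤ n) (ha : a ∈ Finset.Icc 1 n)
    (t : ℝ) (ht : 0 ≤ t) :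
    (((box D n).filter fun x =>
      t ≤ |n * ((Finset.univ.filter fun i => x i = a).card : ℝ) - D|).card : ℝ) * t ^ 2 ≤
      D * n ^ 2 * n ^ D := by
  have hn' : (1 : ℝ) ≤ n := by exact_mod_cast hn
  have key := card_large_deviation_mul_sq_le n D hn
    (fun b => n * (if b = a then 1 else 0) - 1) ?_ ?_ t ht
  · simpa only [Finset.sum_sub_distrib, ← Finset.mul_sum, Finset.sum_boole, Finset.sum_const,
      Finset.card_univ, Fintype.card_fin, nsmul_eq_mul, mul_one] using key
  · rw [Finset.sum_sub_distrib, ← Finset.mul_sum, Finset.sum_ite_eq' (Finset.Icc 1 n) a, if_pos ha]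
    simp
  · intro b _
    rw [abs_le]
    split_ifs <;> constructor <;> linarith

/-- Most points have one of `O(√D)` coordinate sums, and no layer is larger than the middle one. -/
lemma pow_le_mul_card_middleLayer (n D : ℕ) (hn : 1 ≤ n) (hD : 1 ≤ D) :
    (n : ℝ) ^ D ≤ 4 * n * Real.sqrt D * (middleLayer D n).card := by
  have hn' : (1 : ℝ) ≤ n := by exact_mod_cast hn
  have hD' : (1 : ℝ) ≤ D := by exact_mod_cast hD
  have hs1 : 1 ≤ Real.sqrt D := Real.one_le_sqrt.2 hD'
  have hs2 : Real.sqrt D ^ 2 = D := Real.sq_sqrt (by positivity)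
  set r := n * Real.sqrt D with hr
  have hr1 : 1 ≤ r := by nlinarith
  have hdev := card_sum_deviation_mul_sq_le n D hn (2 * r) (by positivity)
  have hdev' : (((box D n).filter fun x =>
      2 * r ≤ |2 * ∑ i, (x i : ℝ) - D * (n + 1)|).card : ℝ) ≤ n ^ D / 4 := by
    rw [mul_pow, hr, mul_pow, hs2] at hdev
    have hp : (0 : ℝ) < D * n ^ 2 := by positivity
    refine le_of_mul_le_mul_right ?_ hp
    linarith
  -- The remaining points lie in at most `2 r + 1` layers.
  have hnear : (((box D n).filter fun x =>
      ¬ 2 * r ≤ |2 * ∑ i, (x i : ℝ) - D * (n + 1)|).card : ℝ) ≤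
      (2 * r + 1) * (middleLayer D n).card := by
    set lo : ℝ := D * (n + 1) / 2 - r
    have hlo : 0 ≤ lo + 2 * r := by
      have : (0 : ℝ) ≤ D * (n + 1) / 2 := by positivity
      simp only [lo]
      linarith
    have hI : ((Finset.Icc ⌈lo⌉₊ ⌊lo + 2 * r⌋₊).card : ℝ) ≤ 2 * r + 1 := by
      rw [Nat.card_Icc]
      rcases le_total ⌈lo⌉₊ (⌊lo + 2 * r⌋₊ + 1) with h | h
      · rw [Nat.cast_sub h]
        push_cast
        linarith [Nat.floor_le hlo, Nat.le_ceil lo]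
      · rw [Nat.sub_eq_zero_of_le h]
        simp only [Nat.cast_zero]
        linarith
    set S := (box D n).filter fun x => ¬ 2 * r ≤ |2 * ∑ i, (x i : ℝ) - D * (n + 1)|
    have h1 : S.card ≤ (middleLayer D n).card * (S.image fun x => ∑ i, x i).card := by
      refine Finset.card_le_mul_card_image _ _ fun s _ => le_trans ?_ (card_layer_le n D s)
      exact Finset.card_le_card (Finset.filter_subset_filter _ (Finset.filter_subset _ _))
    have h2 : (S.image fun x => ∑ i, x i) ⊆ Finset.Icc ⌈lo⌉₊ ⌊lo + 2 * r⌋₊ := by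
      intro s hs
      obtain ⟨x, hx, rfl⟩ := Finset.mem_image.1 hs
      have hx' := (Finset.mem_filter.1 hx).2
      rw [not_le, abs_lt] at hx'
      rw [Finset.mem_Icc, Nat.ceil_le, Nat.le_floor_iff hlo]
      push_cast
      simp only [lo]
      constructor <;> linarith
    have h3 : (S.card : ℝ) ≤ (middleLayer D n).card * (S.image fun x => ∑ i, x i).card := by
      exact_mod_cast h1
    have h4 : ((S.image fun x => ∑ i, x i).card : ℝ) ≤ 2 * r + 1 :=
      (Nat.cast_le.2 (Finset.card_le_card h2)).trans hI
    refine h3.trans ?_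
    rw [mul_comm]
    gcongr
  have hsplit := Finset.card_filter_add_card_filter_not (s := box D n)
    (fun x => 2 * r ≤ |2 * ∑ i, (x i : ℝ) - D * (n + 1)|)
  rw [card_box] at hsplit
  have hsplit' := congrArg (Nat.cast : ℕ → ℝ) hsplit
  push_cast at hsplit'
  have hN : (0 : ℝ) ≤ (middleLayer D n).card := by positivity
  nlinarith

/-! ### Typical points and supersaturation -/

open Classical in
/-- The points of the box in which every value `a ∈ [n]` is taken by at least half of the expected
number `D / n` of coordinates, and whose coordinate sum is close to that of the middle layer. -/
noncomputable def typicalPoints (D n : ℕ) : Finset (Fin D → ℕ) :=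
  (box D n).filter fun x =>
    (∀ a ∈ Finset.Icc 1 n, (D : ℝ) / (2 * n) ≤ (Finset.univ.filter fun i => x i = a).card) ∧
    |2 * ∑ i, (x i : ℝ) - D * (n + 1)| ≤ D / (4 * n)

lemma mem_typicalPoints {D n : ℕ} {x : Fin D → ℕ} :
    x ∈ typicalPoints D n ↔ x ∈ box D n ∧
      (∀ a ∈ Finset.Icc 1 n, (D : ℝ) / (2 * n) ≤ (Finset.univ.filter fun i => x i = a).card) ∧
      |2 * ∑ i, (x i : ℝ) - D * (n + 1)| ≤ D / (4 * n) := by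
  simp [typicalPoints]

lemma typicalPoints_subset_box (D n : ℕ) : typicalPoints D n ⊆ box D n :=
  fun _ hx => (mem_typicalPoints.1 hx).1

lemma card_box_sdiff_typicalPoints_le (n D : ℕ) (hn : 1 ≤ n) (hD : 1 ≤ D) :
    ((box D n \ typicalPoints D n).card : ℝ) ≤ 20 * n ^ 4 * n ^ D / D := by
  have hn' : (1 : ℝ) ≤ n := by exact_mod_cast hn
  have hD' : (1 : ℝ) ≤ D := by exact_mod_cast hD
  set A : ℕ → Finset (Fin D → ℕ) := fun a => (box D n).filter fun x =>
    (D : ℝ) / 2 ≤ |n * ((Finset.univ.filter fun i => x i = a).card : ℝ) - D|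
  set B : Finset (Fin D → ℕ) := (box D n).filter fun x =>
    (D : ℝ) / (4 * n) ≤ |2 * ∑ i, (x i : ℝ) - D * (n + 1)|
  have hsub : box D n \ typicalPoints D n ⊆ (Finset.Icc 1 n).biUnion A ∪ B := by
    intro x hx
    rw [Finset.mem_sdiff] at hx
    rw [Finset.mem_union, Finset.mem_biUnion]
    by_contra hcon
    push Not at hcon
    refine hx.2 (mem_typicalPoints.2 ⟨hx.1, fun a ha => ?_, ?_⟩)
    · have h := hcon.1 a ha
      simp only [A, Finset.mem_filter, hx.1, true_and, not_le, abs_lt] at h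
      rw [div_le_iff₀ (by positivity)]
      linarith
    · have h := hcon.2
      simp only [B, Finset.mem_filter, hx.1, true_and, not_le] at h
      exact h.le
  have hA : ∀ a ∈ Finset.Icc 1 n, ((A a).card : ℝ) ≤ 4 * n ^ 2 * n ^ D / D := by
    intro a ha
    have h := card_level_deviation_mul_sq_le n D a hn ha ((D : ℝ) / 2) (by positivity)
    have hp : (0 : ℝ) < ((D : ℝ) / 2) ^ 2 := by positivity
    refine le_of_mul_le_mul_right (h.trans (le_of_eq ?_)) hp
    field_simp
    ring
  have hB : (B.card : ℝ) ≤ 16 * n ^ 4 * n ^ D / D := by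
    have h := card_sum_deviation_mul_sq_le n D hn ((D : ℝ) / (4 * n)) (by positivity)
    have hp : (0 : ℝ) < ((D : ℝ) / (4 * n)) ^ 2 := by positivity
    refine le_of_mul_le_mul_right (h.trans (le_of_eq ?_)) hp
    field_simp
    ring
  have hcard : ((box D n \ typicalPoints D n).card : ℝ) ≤
      ∑ a ∈ Finset.Icc 1 n, ((A a).card : ℝ) + B.card := by
    have h1 := (Finset.card_le_card hsub).trans (Finset.card_union_le _ _)
    have h2 : ((Finset.Icc 1 n).biUnion A).card ≤ ∑ a ∈ Finset.Icc 1 n, (A a).card :=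
      Finset.card_biUnion_le
    exact_mod_cast h1.trans (Nat.add_le_add_right h2 _)
  have hsum : ∑ a ∈ Finset.Icc 1 n, ((A a).card : ℝ) ≤ n * (4 * n ^ 2 * n ^ D / D) := by
    refine (Finset.sum_le_card_nsmul _ _ _ hA).trans ?_
    simp
  have hp : (n : ℝ) * (4 * n ^ 2 * n ^ D / D) ≤ 4 * n ^ 4 * n ^ D / D := by
    have : (n : ℝ) * (4 * n ^ 2 * n ^ D / D) = 4 * n ^ 3 * n ^ D / D := by ring
    rw [this]
    gcongr
    norm_num
  calc ((box D n \ typicalPoints D n).card : ℝ)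
      ≤ 4 * n ^ 4 * n ^ D / D + 16 * n ^ 4 * n ^ D / D := by linarith
    _ = 20 * n ^ 4 * n ^ D / D := by ring

lemma comp_perm_mem_box {D n : ℕ} {x : Fin D → ℕ} (hx : x ∈ box D n) (σ : Equiv.Perm (Fin D)) :
    x ∘ σ ∈ box D n :=
  mem_box.2 fun i => mem_box.1 hx (σ i)

lemma sum_comp_perm {D : ℕ} (x : Fin D → ℕ) (σ : Equiv.Perm (Fin D)) :
    ∑ i, (x ∘ σ) i = ∑ i, x i :=
  Equiv.sum_comp σ x

open Classical in
/-- If `y` exceeds `x` at `i₀` and agrees with it at the coordinates in `V`, where `x` has the value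
`x i₀`, then the transpositions of `i₀` with the elements of `V` fix `x` and move `y` to `#V`
different points of the same coordinate sum. A chain through (a permutation of) `x` contains at most
one of them. -/
lemma card_perm_same_label_mul_le {n D : ℕ} {α : Type} {c : (Fin D → ℕ) → α}
    (hchain : ∀ x ∈ box D n, ∀ y ∈ box D n, c x = c y → ∑ i, x i ≤ ∑ i, y i → x ≤ y)
    {x y : Fin D → ℕ} (hy : y ∈ box D n) (V : Finset (Fin D)) (i₀ : Fin D)
    (hxV : ∀ v ∈ V, x v = x i₀) (hyV : ∀ v ∈ V, y v = x i₀) (hlt : x i₀ < y i₀) :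
    (Finset.univ.filter fun σ : Equiv.Perm (Fin D) => c (x ∘ σ) = c (y ∘ σ)).card * V.card ≤
      Nat.factorial D := by
  set S : Fin D → Finset (Equiv.Perm (Fin D)) := fun v => Finset.univ.filter
    fun σ => c (x ∘ σ) = c ((y ∘ Equiv.swap i₀ v) ∘ σ)
  have hswap : ∀ v ∈ V, x ∘ Equiv.swap i₀ v = x := by
    intro v hv
    ext i
    simp only [Function.comp_apply, Equiv.swap_apply_def]
    split_ifs with h1 h2
    · rw [h1, hxV v hv]
    · rw [h2, hxV v hv]
    · rfl
  have hcard : ∀ v ∈ V, (S v).card =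
      (Finset.univ.filter fun σ : Equiv.Perm (Fin D) => c (x ∘ σ) = c (y ∘ σ)).card := by
    intro v hv
    refine Finset.card_bij (fun σ _ => Equiv.swap i₀ v * σ) ?_ ?_ ?_
    · intro σ hσ
      simp only [S, Finset.mem_filter, Finset.mem_univ, true_and, Equiv.Perm.coe_mul,
        ← Function.comp_assoc, hswap v hv] at hσ ⊢
      exact hσ
    · intro σ _ τ _ h
      exact mul_left_cancel h
    · intro σ hσ
      refine ⟨Equiv.swap i₀ v * σ, ?_, by rw [← mul_assoc, Equiv.swap_mul_self, one_mul]⟩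
      simp only [S, Finset.mem_filter, Finset.mem_univ, true_and] at hσ ⊢
      have h1 : x ∘ ⇑(Equiv.swap i₀ v * σ) = x ∘ σ := by
        rw [Equiv.Perm.coe_mul, ← Function.comp_assoc, hswap v hv]
      have h2 : (y ∘ Equiv.swap i₀ v) ∘ ⇑(Equiv.swap i₀ v * σ) = y ∘ σ := by
        ext i
        simp
      rw [h1, h2, hσ]
  have hdisj : (V : Set (Fin D)).PairwiseDisjoint S := by
    intro v hv w hw hvw
    refine Finset.disjoint_left.2 fun σ h1 h2 => ?_
    simp only [S, Finset.mem_filter, Finset.mem_univ, true_and] at h1 h2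
    have h := h1.symm.trans h2
    have hm1 := comp_perm_mem_box (comp_perm_mem_box hy (Equiv.swap i₀ v)) σ
    have hm2 := comp_perm_mem_box (comp_perm_mem_box hy (Equiv.swap i₀ w)) σ
    have hs : ∑ i, ((y ∘ Equiv.swap i₀ v) ∘ σ) i = ∑ i, ((y ∘ Equiv.swap i₀ w) ∘ σ) i := by
      simp only [sum_comp_perm]
    have heq := le_antisymm (hchain _ hm1 _ hm2 h hs.le) (hchain _ hm2 _ hm1 h.symm hs.ge)
    have hev := congrFun heq (σ.symm v)
    have hvi : v ≠ i₀ := by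
      rintro rfl
      exact hlt.ne' (hyV v hv)
    simp only [Function.comp_apply, Equiv.apply_symm_apply, Equiv.swap_apply_right,
      Equiv.swap_apply_of_ne_of_ne hvi hvw, hyV v hv] at hev
    exact hlt.ne' hev
  calc _ = ∑ v ∈ V, (S v).card := by
        rw [Finset.sum_congr rfl hcard, Finset.sum_const, smul_eq_mul, mul_comm]
    _ = (V.biUnion S).card := (Finset.card_biUnion hdisj).symm
    _ ≤ (Finset.univ : Finset (Equiv.Perm (Fin D))).card :=
        Finset.card_le_card (Finset.subset_univ _)
    _ = Nat.factorial D := by rw [Finset.card_univ, Fintype.card_perm, Fintype.card_fin]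

open Classical in
/-- After a random permutation of the coordinates, two comparable typical points fall into the same
chain with probability at most `4 n / D`. -/
lemma card_perm_same_label_le_of_typical {n D : ℕ} (hn : 1 ≤ n) {α : Type} {c : (Fin D → ℕ) → α}
    (hchain : ∀ x ∈ box D n, ∀ y ∈ box D n, c x = c y → ∑ i, x i ≤ ∑ i, y i → x ≤ y)
    {x y : Fin D → ℕ} (hx : x ∈ typicalPoints D n) (hy : y ∈ typicalPoints D n) (hxy : x < y) :
    ((Finset.univ.filter fun σ : Equiv.Perm (Fin D) => c (x ∘ σ) = c (y ∘ σ)).card : ℝ) *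
      (D / (4 * n)) ≤ Nat.factorial D := by
  have hn' : (1 : ℝ) ≤ n := by exact_mod_cast hn
  obtain ⟨hle, i₀, hlt⟩ := Pi.lt_def.1 hxy
  obtain ⟨hxb, hxl, hxs⟩ := mem_typicalPoints.1 hx
  obtain ⟨hyb, -, hys⟩ := mem_typicalPoints.1 hy
  set V := Finset.univ.filter fun v => x v = x i₀ ∧ y v = x i₀
  have hV := card_perm_same_label_mul_le hchain hyb V i₀ (fun v hv => (Finset.mem_filter.1 hv).2.1)
    (fun v hv => (Finset.mem_filter.1 hv).2.2) hlt
  have h1 := hxl (x i₀) (Finset.mem_Icc.2 (mem_box.1 hxb i₀))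
  -- Typical points have nearly the same sum, so `y` differs from `x` in few coordinates.
  have h2 : ((Finset.univ.filter fun i => x i = x i₀).card : ℝ) ≤
      V.card + (∑ i, (y i : ℝ) - ∑ i, (x i : ℝ)) := by
    simp only [V, Finset.card_filter, Nat.cast_sum, ← Finset.sum_sub_distrib,
      ← Finset.sum_add_distrib]
    refine Finset.sum_le_sum fun i _ => ?_
    have hi : (x i : ℝ) ≤ y i := by exact_mod_cast hle i
    by_cases ha : x i = x i₀
    · by_cases hb : y i = x i₀
      · simp [ha, hb]
      · have hi' : (x i : ℝ) + 1 ≤ y i := by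
          have : x i < y i := lt_of_le_of_ne (hle i) (by rw [ha]; exact fun h => hb h.symm)
          exact_mod_cast this
        simp only [ha, hb, and_false, if_true, if_false]
        rw [ha] at hi'
        push_cast
        linarith
    · simp only [ha, false_and, if_false]
      push_cast
      linarith
  have h3 : (D : ℝ) / (4 * n) ≤ V.card := by
    have e : (D : ℝ) / (2 * n) = 2 * (D / (4 * n)) := by
      field_simp
      norm_num
    rw [abs_le] at hxs hys
    linarith [hxs.1, hys.2]
  calc _ ≤ ((Finset.univ.filter fun σ : Equiv.Perm (Fin D) => c (x ∘ σ) = c (y ∘ σ)).card : ℝ) *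
        V.card := by gcongr
    _ ≤ Nat.factorial D := by exact_mod_cast hV

open Classical in
/-- Deleting the least point of `F` from each chain leaves at least `#F - N` points, and each of
them is the larger point of a pair in one chain. -/
lemma card_le_card_middleLayer_add_card_pairs {n D : ℕ} {α : Type} {c : (Fin D → ℕ) → α}
    (hchain : ∀ x ∈ box D n, ∀ y ∈ box D n, c x = c y → ∑ i, x i ≤ ∑ i, y i → x ≤ y)
    (hcard : ((box D n).image c).card ≤ (middleLayer D n).card)
    (σ : Equiv.Perm (Fin D)) (F : Finset (Fin D → ℕ)) (hF : F ⊆ box D n) :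
    F.card ≤ (middleLayer D n).card +
      ((F ×ˢ F).filter fun p => p.1 < p.2 ∧ c (p.1 ∘ σ) = c (p.2 ∘ σ)).card := by
  set P := (F ×ˢ F).filter fun p => p.1 < p.2 ∧ c (p.1 ∘ σ) = c (p.2 ∘ σ)
  have hle : ∀ x ∈ F, ∀ y ∈ F, c (x ∘ σ) = c (y ∘ σ) → ∑ i, x i ≤ ∑ i, y i → x ≤ y := by
    intro x hx y hy h hs i
    have := hchain _ (comp_perm_mem_box (hF hx) σ) _ (comp_perm_mem_box (hF hy) σ) h
      (by simpa only [sum_comp_perm] using hs) (σ.symm i)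
    simpa using this
  have h1 : (F \ P.image Prod.snd).card ≤ (middleLayer D n).card := by
    refine (Finset.card_le_card_of_injOn (fun x => c (x ∘ σ)) ?_ ?_).trans hcard
    · intro x hx
      exact Finset.mem_coe.2 (Finset.mem_image_of_mem c
        (comp_perm_mem_box (hF (Finset.mem_sdiff.1 hx).1) σ))
    · intro x hx y hy h
      obtain ⟨hx, hx'⟩ := Finset.mem_sdiff.1 hx
      obtain ⟨hy, hy'⟩ := Finset.mem_sdiff.1 hy
      by_contra hne
      rcases le_total (∑ i, x i) (∑ i, y i) with hs | hs
      · exact hy' (Finset.mem_image.2 ⟨(x, y), Finset.mem_filter.2 ⟨Finset.mk_mem_product hx hy,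
          lt_of_le_of_ne (hle x hx y hy h hs) hne, h⟩, rfl⟩)
      · exact hx' (Finset.mem_image.2 ⟨(y, x), Finset.mem_filter.2 ⟨Finset.mk_mem_product hy hx,
          lt_of_le_of_ne (hle y hy x hx h.symm hs) (Ne.symm hne), h.symm⟩, rfl⟩)
  have h2 : (P.image Prod.snd).card ≤ P.card := Finset.card_image_le
  have h3 : F.card ≤ (F \ P.image Prod.snd).card + (P.image Prod.snd).card :=
    Finset.card_le_card_sdiff_add_card
  omega

open Classical in
/-- Supersaturation: a set of typical points with more than `N` elements contains many comparable
pairs. The bound is the average of the previous one over all `σ`. -/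
lemma mul_le_card_comparable_pairs {n D : ℕ} (hn : 1 ≤ n) (F : Finset (Fin D → ℕ))
    (hF : F ⊆ typicalPoints D n) :
    ((F.card : ℝ) - (middleLayer D n).card) * (D / (4 * n)) ≤
      ((F ×ˢ F).filter fun p => p.1 < p.2).card := by
  obtain ⟨α, c, hchain, hcard⟩ := exists_chain_labelling n D
  have hFb : F ⊆ box D n := hF.trans (typicalPoints_subset_box D n)
  set P := (F ×ˢ F).filter fun p => p.1 < p.2
  set m : ℝ := D / (4 * n)
  have hm : 0 ≤ m := by positivity
  have hD : (0 : ℝ) < Nat.factorial D := by exact_mod_cast Nat.factorial_pos D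
  have hσ : ∀ σ : Equiv.Perm (Fin D), (F.card : ℝ) - (middleLayer D n).card ≤
      (P.filter fun p => c (p.1 ∘ σ) = c (p.2 ∘ σ)).card := by
    intro σ
    have h := card_le_card_middleLayer_add_card_pairs hchain hcard σ F hFb
    rw [← Finset.filter_filter] at h
    rw [sub_le_iff_le_add']
    exact_mod_cast h
  have hswap : ∑ σ : Equiv.Perm (Fin D),
      ((P.filter fun p => c (p.1 ∘ σ) = c (p.2 ∘ σ)).card : ℝ) =
      ∑ p ∈ P, ((Finset.univ.filter fun σ : Equiv.Perm (Fin D) =>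
        c (p.1 ∘ σ) = c (p.2 ∘ σ)).card : ℝ) := by
    simp only [Finset.card_filter, Nat.cast_sum]
    exact Finset.sum_comm
  refine le_of_mul_le_mul_left ?_ hD
  calc (Nat.factorial D : ℝ) * (((F.card : ℝ) - (middleLayer D n).card) * m)
      = (∑ _σ : Equiv.Perm (Fin D), ((F.card : ℝ) - (middleLayer D n).card)) * m := by
        rw [Finset.sum_const, Finset.card_univ, Fintype.card_perm, Fintype.card_fin, nsmul_eq_mul,
          mul_assoc]
    _ ≤ (∑ p ∈ P, ((Finset.univ.filter fun σ : Equiv.Perm (Fin D) =>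
        c (p.1 ∘ σ) = c (p.2 ∘ σ)).card : ℝ)) * m := by
        rw [← hswap]
        exact mul_le_mul_of_nonneg_right (Finset.sum_le_sum fun σ _ => hσ σ) hm
    _ ≤ ∑ p ∈ P, (Nat.factorial D : ℝ) := by
        rw [Finset.sum_mul]
        refine Finset.sum_le_sum fun p hp => ?_
        obtain ⟨hp, hlt⟩ := Finset.mem_filter.1 hp
        obtain ⟨hp1, hp2⟩ := Finset.mem_product.1 hp
        exact card_perm_same_label_le_of_typical hn hchain (hF hp1) (hF hp2) hlt
    _ = Nat.factorial D * P.card := by rw [Finset.sum_const, nsmul_eq_mul, mul_comm]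

open Classical in
lemma exists_le_card_upper {n D : ℕ} (hn : 1 ≤ n) (F : Finset (Fin D → ℕ))
    (hF : F ⊆ typicalPoints D n) (hne : F.Nonempty) (δ : ℝ)
    (hδ : δ * F.card ≤ F.card - (middleLayer D n).card) :
    ∃ v ∈ F, δ * (D / (4 * n)) ≤ (F.filter fun y => v < y).card := by
  have h := mul_le_card_comparable_pairs hn F hF
  have hpairs : (((F ×ˢ F).filter fun p => p.1 < p.2).card : ℝ) =
      ∑ v ∈ F, ((F.filter fun y => v < y).card : ℝ) := by
    simp only [Finset.card_filter, Finset.sum_product, Nat.cast_sum]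
  by_contra hcon
  push Not at hcon
  have h1 := Finset.sum_lt_sum_of_nonempty hne hcon
  rw [Finset.sum_const, nsmul_eq_mul, ← hpairs] at h1
  have hm : (0 : ℝ) ≤ D / (4 * n) := by positivity
  nlinarith [mul_le_mul_of_nonneg_right hδ hm]

/-! ### Counting antichains by deleting points of large degree -/

section Counting

open Classical

variable {β : Type*} [PartialOrder β]

/-- The antichains contained in a finite set `F`. -/
noncomputable def antichainsIn (F : Finset β) : Finset (Finset β) :=
  F.powerset.filter fun A => IsAntichain (· ≤ ·) (A : Set β)

lemma mem_antichainsIn {F A : Finset β} :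
    A ∈ antichainsIn F ↔ A ⊆ F ∧ IsAntichain (· ≤ ·) (A : Set β) := by
  simp [antichainsIn]

lemma card_antichainsIn_le_two_pow (F : Finset β) : (antichainsIn F).card ≤ 2 ^ F.card := by
  rw [← Finset.card_powerset]
  exact Finset.card_filter_le _ _

lemma card_antichainsIn_le_two_pow_sdiff_mul (F G : Finset β) :
    (antichainsIn F).card ≤ 2 ^ (F \ G).card * (antichainsIn G).card := by
  rw [← Finset.card_powerset, ← Finset.card_product]
  refine Finset.card_le_card_of_injOn (fun A => (A \ G, A ∩ G)) ?_ ?_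
  · intro A hA
    obtain ⟨h1, h2⟩ := mem_antichainsIn.1 hA
    refine Finset.mem_coe.2 (Finset.mk_mem_product ?_ ?_)
    · exact Finset.mem_powerset.2 (Finset.sdiff_subset_sdiff h1 subset_rfl)
    · exact mem_antichainsIn.2 ⟨Finset.inter_subset_right,
        h2.subset (by exact_mod_cast Finset.inter_subset_left)⟩
  · intro A _ B _ h
    simp only [Prod.mk.injEq] at h
    rw [← Finset.sdiff_union_inter A G, ← Finset.sdiff_union_inter B G, h.1, h.2]

/-- An antichain either avoids `v`, or contains `v` and no point above it. -/
lemma card_antichainsIn_le_add (F : Finset β) (v : β) :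
    (antichainsIn F).card ≤ (antichainsIn (F.erase v)).card +
      (antichainsIn ((F.erase v).filter fun y => ¬ v < y)).card := by
  rw [← Finset.card_filter_add_card_filter_not (s := antichainsIn F) (fun A => v ∉ A)]
  refine Nat.add_le_add (Finset.card_le_card ?_)
    (Finset.card_le_card_of_injOn (fun A => A.erase v) ?_ ?_)
  · intro A hA
    obtain ⟨hA, hv⟩ := Finset.mem_filter.1 hA
    obtain ⟨h1, h2⟩ := mem_antichainsIn.1 hA
    exact mem_antichainsIn.2 ⟨Finset.subset_erase.2 ⟨h1, hv⟩, h2⟩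
  · intro A hA
    obtain ⟨hA, hv⟩ := Finset.mem_filter.1 hA
    rw [not_not] at hv
    obtain ⟨h1, h2⟩ := mem_antichainsIn.1 hA
    refine Finset.mem_coe.2 (mem_antichainsIn.2 ⟨fun y hy => ?_,
      h2.subset (by exact_mod_cast Finset.erase_subset v A)⟩)
    obtain ⟨hne, hy⟩ := Finset.mem_erase.1 hy
    exact Finset.mem_filter.2 ⟨Finset.mem_erase.2 ⟨hne, h1 hy⟩,
      fun hlt => h2 hv hy hlt.ne hlt.le⟩
  · intro A hA B hB h
    have hA' := not_not.1 (Finset.mem_filter.1 hA).2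
    have hB' := not_not.1 (Finset.mem_filter.1 hB).2
    rw [← Finset.insert_erase hA', ← Finset.insert_erase hB']
    exact congrArg (insert v) h

/-- If every subset of `G` with more than `M` elements has a point with at least `Δ` points above
it, then passing from sets of size at most `M` to `F ⊆ G` costs at most a factor `exp (t * #F)`.
The condition on `t` makes `exp (t * s)` a supersolution of the recursion
`f s = f (s - 1) + f (s - 1 - Δ)`. -/
lemma card_antichainsIn_le_mul_exp (G : Finset β) (M K t Δ : ℝ) (ht : 0 ≤ t) (hK : 0 ≤ K)
    (htΔ : 1 ≤ Real.exp (t * Δ) * t)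
    (hsmall : ∀ F ⊆ G, (F.card : ℝ) ≤ M → ((antichainsIn F).card : ℝ) ≤ K)
    (hlarge : ∀ F ⊆ G, M < F.card → ∃ v ∈ F, Δ ≤ ((F.filter fun y => v < y).card : ℝ))
    (F : Finset β) (hF : F ⊆ G) :
    ((antichainsIn F).card : ℝ) ≤ K * Real.exp (t * F.card) := by
  induction F using Finset.strongInduction with
  | H F ih =>
    rcases le_or_gt (F.card : ℝ) M with hM | hM
    · refine (hsmall F hF hM).trans (le_mul_of_one_le_right hK (Real.one_le_exp (by positivity)))
    obtain ⟨v, hv, hdeg⟩ := hlarge F hF hM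
    set F₁ := F.erase v
    set F₂ := F₁.filter fun y => ¬ v < y
    have hs1 : F₁ ⊂ F := Finset.erase_ssubset hv
    have hs2 : F₂ ⊂ F := (Finset.filter_subset _ _).trans_ssubset hs1
    have h1 := ih F₁ hs1 (hs1.subset.trans hF)
    have h2 := ih F₂ hs2 (hs2.subset.trans hF)
    have h0 : ((antichainsIn F).card : ℝ) ≤ (antichainsIn F₁).card + (antichainsIn F₂).card := by
      exact_mod_cast card_antichainsIn_le_add F v
    have c1 : (F₁.card : ℝ) = F.card - 1 := by
      have : F₁.card + 1 = F.card := Finset.card_erase_add_one hv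
      rw [← this]
      push_cast
      ring
    have c2 : (F₂.card : ℝ) ≤ F.card - 1 - Δ := by
      have e1 := Finset.card_filter_add_card_filter_not (s := F₁) (fun y => v < y)
      have e2 : F₁.filter (fun y => v < y) = F.filter (fun y => v < y) := by
        ext y
        simp only [F₁, Finset.mem_filter, Finset.mem_erase]
        exact ⟨fun h => ⟨h.1.2, h.2⟩, fun h => ⟨⟨h.2.ne', h.1⟩, h.2⟩⟩
      rw [e2] at e1
      have e3 : ((F.filter fun y => v < y).card : ℝ) + F₂.card = F₁.card := by exact_mod_cast e1
      linarith
    have hexp : Real.exp (t * (F.card - 1)) + Real.exp (t * (F.card - 1 - Δ)) ≤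
        Real.exp (t * F.card) := by
      have a1 : t * ((F.card : ℝ) - 1) = t * (F.card - 1 - Δ) + t * Δ := by ring
      have a2 : t * (F.card : ℝ) = t * (F.card - 1 - Δ) + t * Δ + t := by ring
      rw [a1, a2, Real.exp_add _ t, Real.exp_add]
      have a3 := Real.add_one_le_exp t
      have a4 := Real.exp_pos (t * (F.card - 1 - Δ))
      have a5 := Real.exp_pos (t * Δ)
      have a6 : Real.exp (t * Δ) + 1 ≤ Real.exp (t * Δ) * Real.exp t := by nlinarith
      nlinarith
    calc ((antichainsIn F).card : ℝ) ≤ K * Real.exp (t * F₁.card) + K * Real.exp (t * F₂.card) := by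
          linarith
      _ ≤ K * Real.exp (t * (F.card - 1)) + K * Real.exp (t * (F.card - 1 - Δ)) := by
          rw [c1]
          gcongr
      _ ≤ K * Real.exp (t * F.card) := by
          rw [← mul_add]
          gcongr

end Counting

/-! ### The upper bound -/

lemma boxAntichains_eq (D n : ℕ) : boxAntichains D n = antichainsIn (box D n) := by
  ext A
  simp [boxAntichains, antichainsIn]

lemma exp_le_two_rpow {x : ℝ} (hx : 0 ≤ x) : Real.exp x ≤ (2 : ℝ) ^ (2 * x) := by
  rw [Real.rpow_def_of_pos two_pos, Real.exp_le_exp]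
  nlinarith [Real.log_two_gt_d9]

/-- With `t = log D / Δ` the counting lemma applies to all `Δ ≤ D`. -/
lemma one_le_exp_mul {D : ℕ} (hD : 3 ≤ D) {Δ : ℝ} (hΔ : 0 < Δ) (hΔD : Δ ≤ D) :
    1 ≤ Real.exp (Real.log D / Δ * Δ) * (Real.log D / Δ) := by
  have hD' : (3 : ℝ) ≤ D := by exact_mod_cast hD
  have hl : 1 ≤ Real.log D := by
    rw [Real.le_log_iff_exp_le (by linarith)]
    linarith [Real.exp_one_lt_three]
  rw [div_mul_cancel₀ _ hΔ.ne', Real.exp_log (by linarith), mul_div_assoc', le_div_iff₀ hΔ]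
  nlinarith

open Classical in
/-- Two rounds of deletions: points of degree of order `D` while more than `2 N` points are left,
then points of degree of order `√D` down to `(1 + 1 / √D) N` points. -/
lemma card_antichainsIn_typicalPoints_le (n D : ℕ) (hn : 1 ≤ n) (hD : 3 ≤ D) :
    ((antichainsIn (typicalPoints D n)).card : ℝ) ≤
      (2 : ℝ) ^ ((1 + 1 / Real.sqrt D) * (middleLayer D n).card) *
        Real.exp (16 * n * (Real.log D / Real.sqrt D) * (middleLayer D n).card) *
        Real.exp (32 * n ^ 2 * (Real.log D / Real.sqrt D) * (middleLayer D n).card) := by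
  have hn' : (1 : ℝ) ≤ n := by exact_mod_cast hn
  have hD' : (3 : ℝ) ≤ D := by exact_mod_cast hD
  have hpow := pow_le_mul_card_middleLayer n D hn (by omega)
  have hT : ((typicalPoints D n).card : ℝ) ≤ n ^ D := by
    exact_mod_cast (Finset.card_le_card (typicalPoints_subset_box D n)).trans (card_box D n).le
  have hlog : 0 ≤ Real.log D := Real.log_nonneg (by linarith)
  set s := Real.sqrt D
  have hs1 : 1 ≤ s := Real.one_le_sqrt.2 (by linarith)
  have hs2 : s ^ 2 = D := Real.sq_sqrt (by positivity)
  set N : ℝ := ((middleLayer D n).card : ℝ)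
  have hN : 0 < N := by
    have h0 : (0 : ℝ) < n ^ D := by positivity
    by_contra hneg
    have : 4 * n * s * N ≤ 0 := mul_nonpos_of_nonneg_of_nonpos (by positivity) (not_lt.1 hneg)
    linarith
  have hup : ∀ F ⊆ typicalPoints D n, ∀ M δ : ℝ, 0 ≤ M → δ ≤ 1 → N ≤ M * (1 - δ) → M < F.card →
      ∃ v ∈ F, δ * (D / (4 * n)) ≤ (F.filter fun y => v < y).card := by
    intro F hF M δ hM hδ hNM hMF
    have hne : F.Nonempty := by
      rw [← Finset.card_pos]
      exact_mod_cast hM.trans_lt hMF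
    exact exists_le_card_upper hn F hF hne δ (by nlinarith)
  have hΔle : ∀ δ : ℝ, 0 < δ → δ ≤ 1 → δ * (D / (4 * n)) ≤ (D : ℝ) := by
    intro δ h0 h1
    have : (D : ℝ) / (4 * n) ≤ D := div_le_self (by positivity) (by linarith)
    nlinarith [show (0 : ℝ) ≤ D / (4 * n) by positivity]
  have hδ1 : 1 / (2 * s) ≤ 1 := by
    rw [div_le_one (by positivity)]
    linarith
  set K : ℝ := (2 : ℝ) ^ ((1 + 1 / s) * N)
  set Δ₁ : ℝ := 1 / 2 * (D / (4 * n)) with hΔ₁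
  set Δ₂ : ℝ := 1 / (2 * s) * (D / (4 * n)) with hΔ₂
  have hΔ₁pos : 0 < Δ₁ := by positivity
  have hΔ₂pos : 0 < Δ₂ := by positivity
  have hround₂ := card_antichainsIn_le_mul_exp (typicalPoints D n) ((1 + 1 / s) * N) K
    (Real.log D / Δ₂) Δ₂ (by positivity) (by positivity)
    (one_le_exp_mul hD hΔ₂pos (hΔle _ (by positivity) hδ1))
    (by
      intro F _ hF
      calc ((antichainsIn F).card : ℝ) ≤ (2 : ℝ) ^ (F.card : ℝ) := by
            rw [Real.rpow_natCast]
            exact_mod_cast card_antichainsIn_le_two_pow F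
        _ ≤ K := Real.rpow_le_rpow_of_exponent_le one_le_two hF)
    (by
      intro F hF hMF
      refine hup F hF _ (1 / (2 * s)) (by positivity) hδ1 ?_ hMF
      have h1 : 1 / s ≤ 1 := (div_le_one (by positivity)).2 hs1
      have h2 : 1 / (2 * s) = 1 / s / 2 := by field_simp
      have h3 : 0 ≤ 1 / s := by positivity
      rw [h2]
      nlinarith [mul_nonneg h3 (sub_nonneg.2 h1)])
  have hround₁ := card_antichainsIn_le_mul_exp (typicalPoints D n) (2 * N)
    (K * Real.exp (Real.log D / Δ₂ * (2 * N))) (Real.log D / Δ₁) Δ₁ (by positivity) (by positivity)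
    (one_le_exp_mul hD hΔ₁pos (hΔle _ (by norm_num) (by norm_num)))
    (by
      intro F hF hFN
      refine (hround₂ F hF).trans ?_
      gcongr)
    (by
      intro F hF hMF
      exact hup F hF (2 * N) (1 / 2) (by positivity) (by norm_num) (by linarith) hMF)
    _ subset_rfl
  have e₂ : Real.log D / Δ₂ * (2 * N) = 16 * n * (Real.log D / s) * N := by
    rw [hΔ₂, ← hs2]
    field_simp
    ring
  have e₁ : Real.log D / Δ₁ * (typicalPoints D n).card ≤ 32 * n ^ 2 * (Real.log D / s) * N := by
    calc Real.log D / Δ₁ * (typicalPoints D n).card ≤ Real.log D / Δ₁ * (4 * n * s * N) := by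
          gcongr
          exact hT.trans hpow
      _ = 32 * n ^ 2 * (Real.log D / s) * N := by
          rw [hΔ₁, ← hs2]
          field_simp
          ring
  rw [e₂] at hround₁
  refine hround₁.trans ?_
  gcongr

lemma card_boxAntichains_le (n D : ℕ) (hn : 1 ≤ n) (hD : 3 ≤ D) :
    ((boxAntichains D n).card : ℝ) ≤
      (2 : ℝ) ^ ((1 + 177 * n ^ 5 * (Real.log D / Real.sqrt D)) * (middleLayer D n).card) := by
  have hn' : (1 : ℝ) ≤ n := by exact_mod_cast hn
  have hD' : (3 : ℝ) ≤ D := by exact_mod_cast hD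
  have hT := card_antichainsIn_typicalPoints_le n D hn hD
  have hpow := pow_le_mul_card_middleLayer n D hn (by omega)
  have hA := card_box_sdiff_typicalPoints_le n D hn (by omega)
  have hlog : 1 ≤ Real.log D := by
    rw [Real.le_log_iff_exp_le (by linarith)]
    linarith [Real.exp_one_lt_three]
  set s := Real.sqrt D
  have hs1 : 1 ≤ s := Real.one_le_sqrt.2 (by linarith)
  have hs2 : s ^ 2 = D := Real.sq_sqrt (by positivity)
  set N : ℝ := ((middleLayer D n).card : ℝ)
  have hN : 0 ≤ N := by positivity
  set q := Real.log D / s with hq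
  have hq0 : 1 / s ≤ q := by
    rw [hq]
    gcongr
  have hs0 : 0 < 1 / s := by positivity
  have hA' : ((box D n \ typicalPoints D n).card : ℝ) ≤ 80 * n ^ 5 * (1 / s) * N := by
    calc _ ≤ 20 * n ^ 4 * n ^ D / (D : ℝ) := hA
      _ ≤ 20 * n ^ 4 * (4 * n * s * N) / D := by gcongr
      _ = 80 * n ^ 5 * (1 / s) * N := by
        rw [← hs2]
        field_simp
        ring
  have h1 : ((boxAntichains D n).card : ℝ) ≤
      (2 : ℝ) ^ ((box D n \ typicalPoints D n).card : ℝ) *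
        (antichainsIn (typicalPoints D n)).card := by
    have h := card_antichainsIn_le_two_pow_sdiff_mul (box D n) (typicalPoints D n)
    rw [boxAntichains_eq, Real.rpow_natCast]
    exact_mod_cast (by convert h)
  have hq' : 0 ≤ q := hs0.le.trans hq0
  calc ((boxAntichains D n).card : ℝ)
      ≤ (2 : ℝ) ^ (80 * n ^ 5 * (1 / s) * N) * ((2 : ℝ) ^ ((1 + 1 / s) * N) *
          (2 : ℝ) ^ (2 * (16 * n * q * N)) * (2 : ℝ) ^ (2 * (32 * n ^ 2 * q * N))) := by
        refine h1.trans ?_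
        gcongr
        · exact one_le_two
        · refine hT.trans ?_
          gcongr
          · exact exp_le_two_rpow (by positivity)
          · exact exp_le_two_rpow (by positivity)
    _ = (2 : ℝ) ^ ((1 + (80 * n ^ 5 * (1 / s) + 1 / s + 32 * n * q + 64 * n ^ 2 * q)) * N) := by
        rw [← Real.rpow_add two_pos, ← Real.rpow_add two_pos, ← Real.rpow_add two_pos]
        ring_nf
    _ ≤ (2 : ℝ) ^ ((1 + 177 * n ^ 5 * q) * N) := by
        have p1 : (n : ℝ) ≤ n ^ 5 := le_self_pow₀ hn' (by norm_num)
        have p2 : (n : ℝ) ^ 2 ≤ n ^ 5 := pow_le_pow_right₀ hn' (by norm_num)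
        have p0 : (1 : ℝ) ≤ n ^ 5 := one_le_pow₀ hn'
        have r1 : 80 * (n : ℝ) ^ 5 * (1 / s) ≤ 80 * n ^ 5 * q := by gcongr
        have r2 : 1 / s ≤ n ^ 5 * q := by nlinarith
        have r3 : (n : ℝ) * q ≤ n ^ 5 * q := by gcongr
        have r4 : (n : ℝ) ^ 2 * q ≤ n ^ 5 * q := by gcongr
        refine Real.rpow_le_rpow_of_exponent_le one_le_two (mul_le_mul_of_nonneg_right ?_ hN)
        linarith

theorem theorem2 (n : ℕ) (hn : 2 ≤ n) :
    ∃ C : ℝ, 0 < C ∧ ∀ d : ℕ, 2 ≤ d →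
      ((boxAntichains (d + 1) n).card : ℝ) ≤
        (2 : ℝ) ^ ((1 + C * Real.log (d : ℝ) / Real.sqrt (d : ℝ)) *
          ((middleLayer (d + 1) n).card : ℝ)) := by
  have hn' : (2 : ℝ) ≤ n := by exact_mod_cast hn
  refine ⟨354 * n ^ 5, by positivity, fun d hd => ?_⟩
  have hd' : (2 : ℝ) ≤ d := by exact_mod_cast hd
  refine (card_boxAntichains_le n (d + 1) (by omega) (by omega)).trans
    (Real.rpow_le_rpow_of_exponent_le one_le_two ?_)
  have hlog : Real.log ((d + 1 : ℕ) : ℝ) ≤ 2 * Real.log d := by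
    have : 2 * Real.log (d : ℝ) = Real.log ((d : ℝ) ^ 2) := by
      rw [Real.log_pow]
      norm_num
    rw [this]
    refine Real.log_le_log (by positivity) ?_
    push_cast
    nlinarith
  have hlog0 : 0 ≤ Real.log (d : ℝ) := Real.log_nonneg (by linarith)
  have hsqrt : Real.sqrt (d : ℝ) ≤ Real.sqrt ((d + 1 : ℕ) : ℝ) :=
    Real.sqrt_le_sqrt (by push_cast; linarith)
  have hs0 : 0 < Real.sqrt (d : ℝ) := Real.sqrt_pos.2 (by linarith)
  have key : Real.log ((d + 1 : ℕ) : ℝ) / Real.sqrt ((d + 1 : ℕ) : ℝ) ≤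
      2 * Real.log d / Real.sqrt d := by gcongr
  have h177 : 354 * (n : ℝ) ^ 5 * Real.log d / Real.sqrt d =
      177 * n ^ 5 * (2 * Real.log d / Real.sqrt d) := by ring
  rw [h177]
  gcongr
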